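/- Let $H$ be a separable complex Hilbert space with an orthonormal basis $(e_i)_{i\ge 0}$, and let $A\colon H\to H$ be a compact linear operator whose matrix in this basis is lower-triangular: $\langle A e_j\mid e_i\rangle = 0$ for $i<j$. Let $(d_j)_{j\ge 0}$ be a non-decreasing sequence of positive real numbers and let $D$ be the (possibly unbounded) diagonal operator given by $D e_j = d_j e_j$, on its maximal domain $\{x\in H : \sum_j d_j^2\,|\langle x\mid e_j\rangle|^2<\infty\}$. For a compact operator $T\colon H \to H$, let $s_1(T)\ge s_2(T)\ge\cdots\ge 0$ be its singular numbers, i.e. the coefficients, with $s_n(T)\to 0$, of a Schmidt decomposition $Tx=\sum_{n\ge 1} s_n(T)\,\langle x\mid v_n\rangle\,u_n$, where $(u_n)$ and $(v_n)$ are orthonormal sequences in $H$. Then $D^{-1}AD$ is defined on the domain of $D$ and extends to a compact operator on $H$, still denoted $D^{-1}AD$; both $A$ and $D^{-1}AD$ have Schmidt decompositions; and, for every $n\ge 1$, $$\prod_{j=1}^n s_j(D^{-1}AD)\;\le\;\prod_{j=1}^n s_j(A).$$ -/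

import Mathlib

open Filter Topology
open scoped ENNReal lp

/-- The maximal domain `{x | ∑ j, |d j * ⟨x | e j⟩| ^ 2 < ∞}` of the diagonal operator with
diagonal entries `d j` in the orthonormal basis `e`. -/
def diagonalDomain {H : Type*} [NormedAddCommGroup H] [InnerProductSpace ℂ H]
    (e : HilbertBasis ℕ ℂ H) (d : ℕ → ℝ) : Submodule ℂ H where
  carrier := {x | Memℓp (fun j : ℕ => (d j : ℂ) * e.repr x j) 2}
  add_mem' := by
    intro x y hx hy
    have h := Memℓp.add (p := 2) hx hy
    have e1 : (fun j : ℕ => (d j : ℂ) * e.repr (x + y) j)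
        = (fun j : ℕ => (d j : ℂ) * e.repr x j) + fun j : ℕ => (d j : ℂ) * e.repr y j := by
      funext j
      simp [mul_add]
    simpa only [Set.mem_ofPred_eq, e1] using h
  zero_mem' := by
    have e1 : (fun j : ℕ => (d j : ℂ) * e.repr (0 : H) j) = 0 := by
      funext j
      simp
    simpa only [Set.mem_ofPred_eq, e1] using zero_memℓp
  smul_mem' := by
    intro c x hx
    have h := Memℓp.const_smul (p := 2) hx c
    have e1 : (fun j : ℕ => (d j : ℂ) * e.repr (c • x) j)
        = c • fun j : ℕ => (d j : ℂ) * e.repr x j := by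
      funext j
      simp only [map_smul, lp.coeFn_smul, Pi.smul_apply, smul_eq_mul]
      ring
    simpa only [Set.mem_ofPred_eq, e1] using h

theorem diagonalDomain_memℓp {H : Type*} [NormedAddCommGroup H] [InnerProductSpace ℂ H]
    (e : HilbertBasis ℕ ℂ H) (d : ℕ → ℝ) (x : diagonalDomain e d) :
    Memℓp (fun j : ℕ => (d j : ℂ) * e.repr (x : H) j) 2 :=
  x.2

/-- For `x` in the domain of the diagonal operator, the square-summable sequence of coordinates
`d j * ⟨x | e j⟩` of its image. -/
noncomputable def diagonalCoord {H : Type*} [NormedAddCommGroup H] [InnerProductSpace ℂ H]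
    (e : HilbertBasis ℕ ℂ H) (d : ℕ → ℝ) (x : diagonalDomain e d) : ℓ²(ℕ, ℂ) :=
  ⟨fun j : ℕ => (d j : ℂ) * e.repr (x : H) j, diagonalDomain_memℓp e d x⟩

theorem diagonalCoord_apply {H : Type*} [NormedAddCommGroup H] [InnerProductSpace ℂ H]
    (e : HilbertBasis ℕ ℂ H) (d : ℕ → ℝ) (x : diagonalDomain e d) (j : ℕ) :
    diagonalCoord e d x j = (d j : ℂ) * e.repr (x : H) j :=
  rfl

/-- The (possibly unbounded) diagonal operator `D` with `D (e j) = d j • e j`, on its maximal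
domain. -/
noncomputable def diagonalOp {H : Type*} [NormedAddCommGroup H] [InnerProductSpace ℂ H]
    (e : HilbertBasis ℕ ℂ H) (d : ℕ → ℝ) : H →ₗ.[ℂ] H where
  domain := diagonalDomain e d
  toFun :=
    { toFun := fun x => e.repr.symm (diagonalCoord e d x)
      map_add' := by
        intro x y
        rw [← map_add]
        congr 1
        ext j
        simp [diagonalCoord_apply, mul_add]
      map_smul' := by
        intro c x
        rw [RingHom.id_apply, ← map_smul]
        congr 1
        ext j
        simp only [diagonalCoord_apply, Submodule.coe_smul, map_smul, lp.coeFn_smul,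
          Pi.smul_apply, smul_eq_mul]
        ring }

/-- The bounded operator `B` on `H` extends `D⁻¹ A D`, for an injective partially defined `D`: for
every `x` in the domain of `D`, the vector `A (D x)` is in the range of `D`, and its preimage
`y = D⁻¹ (A (D x))` is `B x`. If `D` is densely defined, then there is at most one such `B`. -/
def ExtendsConj {H : Type*} [NormedAddCommGroup H] [InnerProductSpace ℂ H]
    (D : H →ₗ.[ℂ] H) (A B : H →L[ℂ] H) : Prop :=
  ∀ x : D.domain, ∃ y : D.domain, D y = A (D x) ∧ B (x : H) = (y : H)

/-- `s` is the sequence of singular numbers of `T` (numbered from `0`, so that `s n` is the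
`(n + 1)`-st singular number): `T` has a Schmidt decomposition
`T x = ∑ n, s n * ⟨x | v n⟩ • u n`, with orthonormal sequences `u`, `v` and with `s` nonnegative,
non-increasing and tending to `0`. -/
def IsSingularNumbers {H : Type*} [NormedAddCommGroup H] [InnerProductSpace ℂ H]
    (T : H →L[ℂ] H) (s : ℕ → ℝ) : Prop :=
  Antitone s ∧ (∀ n, 0 ≤ s n) ∧ Tendsto s atTop (𝓝 0) ∧
    ∃ u v : ℕ → H, Orthonormal ℂ u ∧ Orthonormal ℂ v ∧
      ∀ x : H, HasSum (fun n => ((s n : ℂ) * inner ℂ (v n) x) • u n) (T x)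

/-!
Products of singular numbers are extremal values of determinants. If `X : E → H` and `Y : H → E` are
contractions and `dim E = n`, then `|det (Y T X)|` is at most the product of the first `n` singular
numbers of `T` (`norm_det_comp_le_prod`, by a min-max comparison with the singular values of the
finite-dimensional operator `Y T X`), and equality holds when `X` and `Y` come from the singular
vectors of `T` (`exists_norm_det_eq_prod`). So it is enough to bound `|det (Y (D⁻¹ A D) X)|` by
the product of the singular numbers of `A`.

This is done by complex interpolation. Cut `D` off to its first `N` diagonal entries and consider
`F z = D⁻ᶻ A Dᶻ`, with matrix entries `(d l / d k) ^ z * ⟨e k, A e l⟩`. As `A` is lower-triangular and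
`d` is non-decreasing, `F` is bounded on the right half-plane. On the imaginary axis the powers of `D`
are contractions, so there `‖F z‖ ≤ ‖A‖`, and `|det (Y (F z) X)|` is bounded by the product of the
singular numbers of `A`. By the Phragmén–Lindelöf principle both bounds persist at `z = 1`
(`norm_comp_conjTrunc_le`).

The norm bound, applied to differences of finite sections of `A`, which converge to `A` in norm because
`A` is compact, shows that the finite sections of `D⁻¹ A D` form a Cauchy sequence
(`cauchySeq_conjTrunc`). Their limit `B` is compact and extends `D⁻¹ A D`, and the determinant bound
passes to it by continuity.

Schmidt decompositions are constructed by successive maximization of `‖T x‖`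
(`exists_isSingularNumbers`).
-/

section

variable {H : Type*} [NormedAddCommGroup H] [InnerProductSpace ℂ H]

/-! ### Finite sums of rank-one operators -/

/-- The finite-rank operator `x ↦ ∑ k ∈ F, c k * ⟨v k, x⟩ • u k`: a partial sum of a Schmidt
decomposition, or, for `u = v = e`, a finite section of a diagonal operator. -/
noncomputable def sumRankOne (u v : ℕ → H) (F : Finset ℕ) (c : ℕ → ℂ) : H →L[ℂ] H :=
  ∑ k ∈ F, c k • InnerProductSpace.rankOne ℂ (u k) (v k)

theorem sumRankOne_apply (u v : ℕ → H) (F : Finset ℕ) (c : ℕ → ℂ) (x : H) :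
    sumRankOne u v F c x = ∑ k ∈ F, (c k * inner ℂ (v k) x) • u k := by
  simp [sumRankOne, smul_smul]

theorem Orthonormal.norm_sq_sum_smul {ι : Type*} {u : ι → H} (hu : Orthonormal ℂ u)
    (F : Finset ι) (c : ι → ℂ) : ‖∑ k ∈ F, c k • u k‖ ^ 2 = ∑ k ∈ F, ‖c k‖ ^ 2 := by
  rw [← Complex.ofReal_inj]
  push_cast
  rw [← Complex.coe_algebraMap, ← inner_self_eq_norm_sq_to_K (𝕜 := ℂ), hu.inner_sum]
  simp [Complex.conj_mul']

theorem norm_sumRankOne_le {u v : ℕ → H} (hu : Orthonormal ℂ u) (hv : Orthonormal ℂ v)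
    (F : Finset ℕ) (c : ℕ → ℂ) {r : ℝ} (hr : 0 ≤ r) (hc : ∀ k ∈ F, ‖c k‖ ≤ r) :
    ‖sumRankOne u v F c‖ ≤ r := by
  refine ContinuousLinearMap.opNorm_le_bound _ hr fun x => ?_
  rw [sumRankOne_apply]
  refine le_of_sq_le_sq ?_ (by positivity)
  rw [hu.norm_sq_sum_smul, mul_pow]
  calc ∑ k ∈ F, ‖c k * inner ℂ (v k) x‖ ^ 2
      ≤ ∑ k ∈ F, r ^ 2 * ‖inner ℂ (v k) x‖ ^ 2 := by
        refine Finset.sum_le_sum fun k hk => ?_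
        rw [norm_mul, mul_pow]
        gcongr
        exact hc k hk
    _ = r ^ 2 * ∑ k ∈ F, ‖inner ℂ (v k) x‖ ^ 2 := by rw [Finset.mul_sum]
    _ ≤ r ^ 2 * ‖x‖ ^ 2 := by
        gcongr
        exact hv.sum_inner_products_le x

/-! ### Tails of Schmidt decompositions -/

/-- The `m`-th singular number bounds the operator on the orthogonal complement of the first `m`
right singular vectors. This is the only property of singular numbers that enters the upper bound
for determinants. -/
theorem norm_apply_le_of_hasSum {T : H →L[ℂ] H} {s : ℕ → ℝ} (hs : Antitone s)
    (hs0 : ∀ n, 0 ≤ s n) {u v : ℕ → H} (hu : Orthonormal ℂ u) (hv : Orthonormal ℂ v)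
    (hT : ∀ x : H, HasSum (fun n => ((s n : ℂ) * inner ℂ (v n) x) • u n) (T x))
    (m : ℕ) (x : H) (hx : ∀ j < m, inner ℂ (v j) x = 0) : ‖T x‖ ≤ s m * ‖x‖ := by
  refine le_of_tendsto (hT x).norm (Eventually.of_forall fun F => ?_)
  have h1 : ∑ k ∈ F, ((s k : ℂ) * inner ℂ (v k) x) • u k
      = sumRankOne u v (F.filter (m ≤ ·)) (fun k => (s k : ℂ)) x := by
    rw [sumRankOne_apply, Finset.sum_filter]
    refine Finset.sum_congr rfl fun k _ => ?_
    split_ifs with hk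
    · rfl
    · simp [hx k (not_le.mp hk)]
  rw [h1]
  refine ContinuousLinearMap.le_of_opNorm_le _ (norm_sumRankOne_le hu hv _ _ (hs0 m) ?_) x
  intro k hk
  rw [Complex.norm_real, Real.norm_of_nonneg (hs0 k)]
  exact hs (Finset.mem_filter.mp hk).2

theorem apply_eq_of_hasSum {T : H →L[ℂ] H} {s : ℕ → ℝ} {u v : ℕ → H} (hv : Orthonormal ℂ v)
    (hT : ∀ x : H, HasSum (fun n => ((s n : ℂ) * inner ℂ (v n) x) • u n) (T x)) (j : ℕ) :
    T (v j) = (s j : ℂ) • u j := by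
  refine (hT (v j)).unique ?_
  have := hasSum_single (f := fun n => ((s n : ℂ) * inner ℂ (v n) (v j)) • u n) j (by
    intro n hn
    simp [orthonormal_iff_ite.mp hv, hn])
  simpa [orthonormal_iff_ite.mp hv, hv.1 j] using this

theorem norm_sub_sumRankOne_le {T : H →L[ℂ] H} {s : ℕ → ℝ} (hs0 : ∀ n, 0 ≤ s n)
    {u v : ℕ → H} (hv : Orthonormal ℂ v) (hTv : ∀ j, T (v j) = (s j : ℂ) • u j)
    (htail : ∀ m x, (∀ j < m, inner ℂ (v j) x = 0) → ‖T x‖ ≤ s m * ‖x‖) (m : ℕ) :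
    ‖T - sumRankOne u v (Finset.range m) (fun k => (s k : ℂ))‖ ≤ s m := by
  refine ContinuousLinearMap.opNorm_le_bound _ (hs0 m) fun x => ?_
  set p : H := ∑ k ∈ Finset.range m, inner ℂ (v k) x • v k with hp
  have h1 : (T - sumRankOne u v (Finset.range m) (fun k => (s k : ℂ))) x = T (x - p) := by
    simp only [sub_apply, sumRankOne_apply, map_sub, hp, map_sum, map_smul,
      hTv, smul_smul, mul_comm]
  have h2 : ∀ j < m, inner ℂ (v j) (x - p) = 0 := by
    intro j hj
    rw [inner_sub_right, hp, hv.inner_right_sum _ (Finset.mem_range.mpr hj), sub_self]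
  have h3 : inner ℂ p (x - p) = 0 := by
    conv_lhs => enter [2]; rw [hp]
    rw [sum_inner]
    refine Finset.sum_eq_zero fun j hj => ?_
    rw [inner_smul_left, h2 j (Finset.mem_range.mp hj), mul_zero]
  have h4 : ‖x - p‖ ≤ ‖x‖ := by
    have := norm_add_sq_eq_norm_sq_add_norm_sq_of_inner_eq_zero p (x - p) h3
    rw [add_sub_cancel] at this
    nlinarith [norm_nonneg x, norm_nonneg (x - p), mul_self_nonneg ‖p‖]
  rw [h1]
  exact (htail m _ h2).trans (by gcongr; exact hs0 m)

/-! ### Existence of Schmidt decompositions -/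

/-- A compact operator attains its norm at a unit vector `v`, which is an eigenvector of `T* T`, so
that `T` maps `vᗮ` into `(T v)ᗮ`. A maximizing sequence `x n` satisfies `T* T (x n) - ‖T‖² x n → 0`
and thus converges along any subsequence on which `T (x n)` does. -/
theorem exists_norm_attaining {E F : Type*} [NormedAddCommGroup E] [InnerProductSpace ℂ E]
    [CompleteSpace E] [Nontrivial E] [NormedAddCommGroup F] [InnerProductSpace ℂ F]
    [CompleteSpace F] (T : E →L[ℂ] F) (hT : IsCompactOperator T) :
    ∃ v : E, ‖v‖ = 1 ∧ (∀ w, ‖T w‖ ≤ ‖T v‖ * ‖w‖) ∧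
      ∀ w, inner ℂ v w = 0 → inner ℂ (T v) (T w) = 0 := by
  rcases eq_or_ne T 0 with rfl | hT0
  · obtain ⟨v, hv⟩ := exists_norm_eq E zero_le_one
    exact ⟨v, hv, by simp, by simp⟩
  set s : ℝ := ‖T‖ with hs
  have hs0 : 0 < s := norm_pos_iff.mpr hT0
  set S := ContinuousLinearMap.adjoint T with hS
  have key : ∀ x : E, ‖x‖ = 1 →
      ‖S (T x) - ((s ^ 2 : ℝ) : ℂ) • x‖ ^ 2 ≤ 2 * s ^ 2 * (s ^ 2 - ‖T x‖ ^ 2) := by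
    intro x hx
    have h1 : ‖S (T x)‖ ≤ s * ‖T x‖ := by
      have := S.le_opNorm (T x)
      rwa [hS, LinearIsometryEquiv.norm_map] at this
    have h2 : ‖T x‖ ≤ s := by simpa [hx] using T.le_opNorm x
    have h3 : RCLike.re (inner ℂ (S (T x)) (((s ^ 2 : ℝ) : ℂ) • x)) = s ^ 2 * ‖T x‖ ^ 2 := by
      rw [inner_smul_right, hS, ContinuousLinearMap.adjoint_inner_left, inner_self_eq_norm_sq_to_K]
      norm_cast
      exact (Complex.re_ofReal_mul _ _).trans (congrArg _ (Complex.ofReal_re _))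
    rw [@norm_sub_sq ℂ, h3, norm_smul, hx, Complex.norm_real, Real.norm_of_nonneg (by positivity)]
    have h4 : ‖S (T x)‖ ^ 2 ≤ (s * ‖T x‖) ^ 2 := by gcongr
    have h5 : ‖T x‖ ^ 2 ≤ s ^ 2 := by gcongr
    nlinarith [sq_nonneg s]
  obtain ⟨x, hx1, hx2⟩ : ∃ x : ℕ → E, (∀ n, ‖x n‖ = 1) ∧
      Tendsto (fun n => ‖T (x n)‖) atTop (𝓝 s) := by
    have : ∀ n : ℕ, ∃ x : E, ‖x‖ = 1 ∧ s - 1 / ((n : ℝ) + 1) < ‖T x‖ := by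
      intro n
      have h1 : s - 1 / ((n : ℝ) + 1) < s := by
        have : 0 < 1 / ((n : ℝ) + 1) := by positivity
        linarith
      by_contra! hcon
      have h2 : ‖T‖ ≤ max 0 (s - 1 / ((n : ℝ) + 1)) := by
        refine ContinuousLinearMap.opNorm_le_of_unit_norm (le_max_left _ _) fun y hy => ?_
        exact (hcon y hy).trans (le_max_right _ _)
      exact absurd h2 (not_le.mpr (max_lt hs0 h1))
    choose x hx1 hx2 using this
    refine ⟨x, hx1, tendsto_of_tendsto_of_tendsto_of_le_of_le (g := fun n : ℕ => s - 1 / ((n : ℝ) + 1))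
      (h := fun _ => s) ?_ tendsto_const_nhds (fun n => (hx2 n).le) fun n => ?_⟩
    · simpa using tendsto_one_div_add_atTop_nhds_zero_nat.const_sub s
    · simpa [hx1] using T.le_opNorm (x n)
  obtain ⟨K, hK, hKT⟩ := IsCompactOperator.image_closedBall_subset_compact (f := T.toLinearMap) hT 1
  obtain ⟨y, -, φ, hφ, hy⟩ := hK.tendsto_subseq (x := fun n => T (x n)) fun n =>
    hKT ⟨x n, by simp [hx1], rfl⟩
  -- along the subsequence, `S (T x) - s² x → 0`, so `x` converges as well
  have hlim0 : Tendsto (fun n => S (T (x (φ n))) - ((s ^ 2 : ℝ) : ℂ) • x (φ n)) atTop (𝓝 0) := by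
    rw [tendsto_zero_iff_norm_tendsto_zero]
    have h1 : Tendsto (fun n => 2 * s ^ 2 * (s ^ 2 - ‖T (x (φ n))‖ ^ 2)) atTop (𝓝 0) := by
      have := (((hx2.comp hφ.tendsto_atTop).pow 2).const_sub (s ^ 2)).const_mul (2 * s ^ 2)
      simpa using this
    have h2 := squeeze_zero (fun n => sq_nonneg _) (fun n => key (x (φ n)) (hx1 _)) h1
    simpa [Real.sqrt_sq] using h2.sqrt
  have hsc : ((s ^ 2 : ℝ) : ℂ) ≠ 0 := by exact_mod_cast (pow_pos hs0 2).ne'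
  have hlim : Tendsto (fun n => x (φ n)) atTop (𝓝 ((((s ^ 2 : ℝ) : ℂ))⁻¹ • S y)) := by
    have h1 : Tendsto (fun n => S (T (x (φ n)))) atTop (𝓝 (S y)) :=
      (S.continuous.tendsto y).comp hy
    have h2 := (h1.sub hlim0).const_smul (((s ^ 2 : ℝ) : ℂ))⁻¹
    simpa only [smul_sub, smul_smul, inv_mul_cancel₀ hsc, one_smul, sub_sub_cancel, sub_zero] using h2
  set v := (((s ^ 2 : ℝ) : ℂ))⁻¹ • S y
  have hv1 : ‖v‖ = 1 := by
    refine tendsto_nhds_unique hlim.norm ?_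
    simp [hx1]
  have hTv : ‖T v‖ = s := by
    refine tendsto_nhds_unique ((T.continuous.tendsto v).comp hlim).norm ?_
    exact hx2.comp hφ.tendsto_atTop
  refine ⟨v, hv1, fun w => by rw [hTv]; exact T.le_opNorm w, fun w hw => ?_⟩
  have h1 : S (T v) = ((s ^ 2 : ℝ) : ℂ) • v := by
    have := key v hv1
    rw [hTv, sub_self, mul_zero] at this
    exact sub_eq_zero.mp (norm_eq_zero.mp (pow_eq_zero_iff two_ne_zero |>.mp
      (le_antisymm this (sq_nonneg _))))
  rw [← ContinuousLinearMap.adjoint_inner_left, ← hS, h1, inner_smul_left, hw, mul_zero]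

/-- Recursive choice of a sequence in which `u n` depends on `n` and on the finite set of all
earlier terms. -/
theorem exists_seq_of_finset {α : Type*} [DecidableEq α] (f : ℕ → Finset α → α) :
    ∃ (u : ℕ → α) (S : ℕ → Finset α), (∀ n, u n = f n (S n)) ∧
      (∀ n, ∀ x ∈ S n, ∃ m < n, x = u m) ∧ ∀ m n, m < n → u m ∈ S n := by
  let S : ℕ → Finset α := fun n => Nat.rec ∅ (fun k T => insert (f k T) T) n
  have hS : ∀ n, S (n + 1) = insert (f n (S n)) (S n) := fun n => rfl
  refine ⟨fun n => f n (S n), S, fun n => rfl, fun n => ?_, fun m n hmn => ?_⟩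
  · induction n with
    | zero => intro x hx; exact absurd hx (Finset.notMem_empty x)
    | succ n ih =>
      intro x hx
      rw [hS, Finset.mem_insert] at hx
      rcases hx with hx | hx
      · exact ⟨n, n.lt_succ_self, hx⟩
      · obtain ⟨m, hm, h⟩ := ih x hx
        exact ⟨m, hm.trans n.lt_succ_self, h⟩
  · induction n, hmn using Nat.le_induction with
    | base => rw [hS]; exact Finset.mem_insert_self _ _
    | succ k _ ih => rw [hS]; exact Finset.mem_insert_of_mem ih

theorem orthonormal_of_lt {u : ℕ → H} (h1 : ∀ n, ‖u n‖ = 1)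
    (h : ∀ m n, m < n → inner ℂ (u m) (u n) = 0) : Orthonormal ℂ u := by
  refine ⟨h1, fun m n hmn => ?_⟩
  rcases lt_or_gt_of_ne hmn with hlt | hlt
  · exact h m n hlt
  · exact inner_eq_zero_symm.mp (h n m hlt)

theorem nontrivial_orthogonal_span_finset [CompleteSpace H] {e : ℕ → H} (he : Orthonormal ℂ e)
    (S : Finset H) : Nontrivial (Submodule.span ℂ (S : Set H))ᗮ := by
  rw [Submodule.nontrivial_iff_ne_bot]
  intro h
  rw [Submodule.orthogonal_eq_bot_iff] at h
  have : Module.Finite ℂ H := ⟨⟨S, h⟩⟩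
  exact not_finite_iff_infinite.mpr inferInstance he.linearIndependent.finite

/-- In an infinite-dimensional space, `exists_norm_attaining` applies on the orthogonal complement of
a finite set. -/
theorem exists_greedy [CompleteSpace H] {e : ℕ → H} (he : Orthonormal ℂ e) (T : H →L[ℂ] H)
    (hT : IsCompactOperator T) (S : Finset H) :
    ∃ v : H, ‖v‖ = 1 ∧ (∀ x ∈ S, inner ℂ x v = 0) ∧
      (∀ w, (∀ x ∈ S, inner ℂ x w = 0) → ‖T w‖ ≤ ‖T v‖ * ‖w‖) ∧
      ∀ w, (∀ x ∈ S, inner ℂ x w = 0) → inner ℂ v w = 0 → inner ℂ (T v) (T w) = 0 := by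
  have := nontrivial_orthogonal_span_finset he S
  obtain ⟨v, hv1, hv2, hv3⟩ := exists_norm_attaining
    (T ∘L (Submodule.span ℂ (S : Set H))ᗮ.subtypeL) (hT.comp_clm _)
  have hmem : ∀ w, (∀ x ∈ S, inner ℂ x w = 0) → w ∈ (Submodule.span ℂ (S : Set H))ᗮ := by
    intro w hw
    rw [Submodule.mem_orthogonal]
    intro y hy
    induction hy using Submodule.span_induction with
    | mem x hx => exact hw x hx
    | zero => simp
    | add x y _ _ hx hy => rw [inner_add_left, hx, hy, add_zero]
    | smul a x _ hx => rw [inner_smul_left, hx, mul_zero]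
  refine ⟨v, by simpa using hv1, fun x hx => ?_, fun w hw => ?_, fun w hw hvw => ?_⟩
  · exact (Submodule.mem_orthogonal _ _).mp v.2 x (Submodule.subset_span hx)
  · simpa using hv2 ⟨w, hmem w hw⟩
  · simpa using hv3 ⟨w, hmem w hw⟩ hvw

/-- By compactness `T (v n)` converges along a subsequence; consecutive terms of it are orthogonal,
so their distance is at least the norm of either. -/
theorem tendsto_norm_apply_of_compact {T : H →L[ℂ] H} (hT : IsCompactOperator T) {v : ℕ → H}
    (hv : ∀ n, ‖v n‖ = 1) (hanti : Antitone fun n => ‖T (v n)‖)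
    (horth : ∀ m n, m < n → inner ℂ (T (v m)) (T (v n)) = 0) :
    Tendsto (fun n => ‖T (v n)‖) atTop (𝓝 0) := by
  obtain ⟨K, hK, hKT⟩ := IsCompactOperator.image_closedBall_subset_compact (f := T.toLinearMap) hT 1
  obtain ⟨y, -, φ, hφ, hy⟩ := hK.tendsto_subseq (x := fun n => T (v n)) fun n =>
    hKT ⟨v n, by simp [hv], rfl⟩
  rw [tendsto_iff_tendsto_subseq_of_antitone hanti hφ.tendsto_atTop]
  have h1 := (hy.sub (hy.comp (tendsto_add_atTop_nat 1))).norm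
  rw [sub_self, norm_zero] at h1
  refine squeeze_zero (fun n => norm_nonneg _) (fun n => ?_) h1
  simp only [Function.comp_apply]
  have h2 : ‖T (v (φ n)) - T (v (φ (n + 1)))‖ ^ 2
      = ‖T (v (φ n))‖ ^ 2 + ‖T (v (φ (n + 1)))‖ ^ 2 := by
    rw [@norm_sub_sq ℂ, horth _ _ (hφ n.lt_succ_self)]
    simp
  exact le_of_sq_le_sq (by rw [h2]; nlinarith [sq_nonneg ‖T (v (φ (n + 1)))‖]) (norm_nonneg _)

theorem hasSum_of_tail [CompleteSpace H] {T : H →L[ℂ] H} {s : ℕ → ℝ} (hs0 : ∀ n, 0 ≤ s n)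
    (hs : Tendsto s atTop (𝓝 0)) {u v : ℕ → H} (hu : Orthonormal ℂ u)
    (hv : Orthonormal ℂ v) (hTv : ∀ j, T (v j) = (s j : ℂ) • u j)
    (htail : ∀ m x, (∀ j < m, inner ℂ (v j) x = 0) → ‖T x‖ ≤ s m * ‖x‖) (x : H) :
    HasSum (fun n => ((s n : ℂ) * inner ℂ (v n) x) • u n) (T x) := by
  obtain ⟨C, hC⟩ := hs.bddAbove_range
  have hsC : ∀ n, s n ≤ C := fun n => hC ⟨n, rfl⟩
  have hsum : Summable (fun n => ((s n : ℂ) * inner ℂ (v n) x) • u n) := by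
    have h := hu.orthogonalFamily.summable_iff_norm_sq_summable
      (fun n => (s n : ℂ) * inner ℂ (v n) x)
    simp only [LinearIsometry.toSpanSingleton_apply] at h
    rw [h]
    refine Summable.of_nonneg_of_le (fun n => sq_nonneg _) (fun n => ?_)
      ((hv.inner_products_summable x).mul_left (C ^ 2))
    rw [norm_mul, mul_pow, Complex.norm_real, Real.norm_of_nonneg (hs0 n)]
    have := hs0 n
    gcongr
    exact hsC n
  have h1 : Tendsto (fun m => sumRankOne u v (Finset.range m) (fun k => (s k : ℂ))) atTop (𝓝 T) := by
    rw [tendsto_iff_norm_sub_tendsto_zero]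
    refine squeeze_zero (fun n => norm_nonneg _) (fun n => ?_) hs
    rw [norm_sub_rev]
    exact norm_sub_sumRankOne_le hs0 hv hTv htail n
  have h2 : Tendsto (fun m => sumRankOne u v (Finset.range m) (fun k => (s k : ℂ)) x) atTop
      (𝓝 (T x)) := ((ContinuousLinearMap.apply ℂ H x).continuous.tendsto T).comp h1
  simp only [sumRankOne_apply] at h2
  rw [tendsto_nhds_unique h2 hsum.hasSum.tendsto_sum_nat]
  exact hsum.hasSum

/-- The right singular vectors `v n` are chosen greedily, `v n` maximizing `‖T x‖` over the unit
vectors orthogonal to `v 0, …, v (n - 1)`. The left singular vectors are the normalized `T (v n)`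
while these do not vanish, and arbitrary vectors orthogonal to the earlier ones from then on. -/
theorem exists_isSingularNumbers [CompleteSpace H] {e : ℕ → H} (he : Orthonormal ℂ e)
    (T : H →L[ℂ] H) (hT : IsCompactOperator T) : ∃ s, IsSingularNumbers T s := by
  classical
  choose f hf1 hf2 hf3 hf4 using exists_greedy he T hT
  obtain ⟨v, S, hv, hS, hSv⟩ := exists_seq_of_finset fun _ => f
  have hmem : ∀ n w, (∀ j < n, inner ℂ (v j) w = 0) → ∀ x ∈ S n, inner ℂ x w = 0 := by
    intro n w hw x hx
    obtain ⟨m, hm, rfl⟩ := hS n x hx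
    exact hw m hm
  have hv1 : ∀ n, ‖v n‖ = 1 := fun n => by rw [hv]; exact hf1 _
  have hvo : ∀ m n, m < n → inner ℂ (v m) (v n) = 0 := by
    intro m n hmn
    rw [hv n]
    exact hf2 _ _ (hSv m n hmn)
  have htail : ∀ m x, (∀ j < m, inner ℂ (v j) x = 0) → ‖T x‖ ≤ ‖T (v m)‖ * ‖x‖ := by
    intro m x hx
    rw [hv m]
    exact hf3 _ _ (hmem m x hx)
  have hTo : ∀ m n, m < n → inner ℂ (T (v m)) (T (v n)) = 0 := by
    intro m n hmn
    have h1 := hvo m n hmn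
    rw [hv m] at h1 ⊢
    exact hf4 _ _ (hmem m _ fun j hj => hvo j n (hj.trans hmn)) h1
  have hanti : Antitone fun n => ‖T (v n)‖ := by
    refine antitone_nat_of_succ_le fun n => ?_
    simpa [hv1] using htail n (v (n + 1)) fun j hj => hvo j _ (hj.trans n.lt_succ_self)
  have hlim := tendsto_norm_apply_of_compact hT hv1 hanti hTo
  choose g hg1 hg2 _ _ using exists_greedy he (0 : H →L[ℂ] H) isCompactOperator_zero
  obtain ⟨u, R, hu, -, hRu⟩ := exists_seq_of_finset fun n R =>
    if T (v n) = 0 then g R else ((‖T (v n)‖ : ℂ))⁻¹ • T (v n)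
  have hu0 : ∀ n, T (v n) = 0 → u n = g (R n) := fun n h => by rw [hu n, if_pos h]
  have hun : ∀ n, T (v n) ≠ 0 → u n = ((‖T (v n)‖ : ℂ))⁻¹ • T (v n) := fun n h => by
    rw [hu n, if_neg h]
  have huO : Orthonormal ℂ u := by
    refine orthonormal_of_lt (fun n => ?_) fun m n hmn => ?_
    · by_cases h : T (v n) = 0
      · rw [hu0 n h]; exact hg1 _
      · rw [hun n h, norm_smul, norm_inv, Complex.norm_real, norm_norm,
          inv_mul_cancel₀ (norm_ne_zero_iff.mpr h)]
    · by_cases h : T (v n) = 0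
      · rw [hu0 n h]; exact hg2 _ _ (hRu m n hmn)
      · have h' : T (v m) ≠ 0 := by
          rw [← ne_eq, ← norm_pos_iff] at h
          rw [← norm_pos_iff]
          exact h.trans_le (hanti hmn.le)
        rw [hun n h, hun m h', inner_smul_left, inner_smul_right, hTo m n hmn, mul_zero, mul_zero]
  have hTu : ∀ j, T (v j) = (‖T (v j)‖ : ℂ) • u j := by
    intro j
    by_cases h : T (v j) = 0
    · simp [h]
    · rw [hun j h, smul_smul, mul_inv_cancel₀, one_smul]
      exact_mod_cast norm_ne_zero_iff.mpr h
  have hvO := orthonormal_of_lt hv1 hvo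
  exact ⟨fun n => ‖T (v n)‖, hanti, fun n => norm_nonneg _, hlim, u, v, huO, hvO,
    hasSum_of_tail (fun n => norm_nonneg _) hlim huO hvO hTu htail⟩

/-! ### Determinants of finite-dimensional compressions -/

/-- Courant–Fischer comparison: the span of the top `k + 1` right singular vectors of `M` contains a
nonzero `w` whose image `X w` is orthogonal to `v 0, …, v (k - 1)`. -/
theorem singularValues_le_of_tail {E : Type*} [NormedAddCommGroup E] [InnerProductSpace ℂ E]
    [FiniteDimensional ℂ E] (M : E →ₗ[ℂ] E) (T : H →L[ℂ] H) (X : E →L[ℂ] H) (hX : ‖X‖ ≤ 1)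
    (hM : ∀ w, ‖M w‖ ≤ ‖T (X w)‖) {k : ℕ} (hk : k < Module.finrank ℂ E) {r : ℝ} (hr : 0 ≤ r)
    {v : ℕ → H} (htail : ∀ x, (∀ j < k, inner ℂ (v j) x = 0) → ‖T x‖ ≤ r * ‖x‖) :
    M.singularValues k ≤ r := by
  set n := Module.finrank ℂ E with hn
  let b := M.isSymmetric_adjoint_comp_self.eigenvectorBasis hn.symm
  let ev := M.isSymmetric_adjoint_comp_self.eigenvalues hn.symm
  have hb : ∀ i, LinearMap.adjoint M (M (b i)) = (ev i : ℂ) • b i := fun i =>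
    M.isSymmetric_adjoint_comp_self.apply_eigenvectorBasis hn.symm i
  have hev : Antitone ev := M.isSymmetric_adjoint_comp_self.eigenvalues_antitone hn.symm
  let ι : Fin (k + 1) → Fin n := Fin.castLE hk
  let g : (Fin (k + 1) → ℂ) →ₗ[ℂ] E := Fintype.linearCombination ℂ (b ∘ ι)
  have hg : ∀ c, g c = ∑ i, c i • b (ι i) := fun c => Fintype.linearCombination_apply ℂ _ c
  have hbo : Orthonormal ℂ (b ∘ ι) := b.orthonormal.comp ι (Fin.castLE_injective hk)
  -- `k` linear conditions on `k + 1` coefficients have a nontrivial solution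
  let L : (Fin (k + 1) → ℂ) →ₗ[ℂ] (Fin k → ℂ) :=
    LinearMap.pi fun j => (innerSL ℂ (v j)).toLinearMap ∘ₗ X.toLinearMap ∘ₗ g
  have hL : LinearMap.ker L ≠ ⊥ := LinearMap.ker_ne_bot_of_finrank_lt (by simp)
  obtain ⟨c, hcL, hc0⟩ := (Submodule.ne_bot_iff _).mp hL
  have hXw : ∀ j < k, inner ℂ (v j) (X (g c)) = 0 := by
    intro j hj
    exact congrFun (LinearMap.mem_ker.mp hcL) ⟨j, hj⟩
  have hw : ‖g c‖ ^ 2 = ∑ i, ‖c i‖ ^ 2 := by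
    rw [hg]; exact hbo.norm_sq_sum_smul Finset.univ c
  have hMw : ‖M (g c)‖ ^ 2 = ∑ i, ev (ι i) * ‖c i‖ ^ 2 := by
    rw [← Complex.ofReal_inj]
    push_cast
    rw [← Complex.coe_algebraMap, ← inner_self_eq_norm_sq_to_K (𝕜 := ℂ),
      ← LinearMap.adjoint_inner_right]
    have h1 : LinearMap.adjoint M (M (g c)) = ∑ i, ((ev (ι i) : ℂ) * c i) • (b ∘ ι) i := by
      rw [hg]
      simp only [map_sum, map_smul, hb, smul_smul, mul_comm, Function.comp_apply]
    have h2 : g c = ∑ i, c i • (b ∘ ι) i := hg c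
    rw [h1, h2, hbo.inner_sum]
    refine Finset.sum_congr rfl fun i _ => ?_
    rw [mul_left_comm, Complex.conj_mul']
    simp
  have hpos : 0 < ‖g c‖ := by
    have h1 : g c ≠ 0 := by
      intro h0
      rw [h0, norm_zero, zero_pow two_ne_zero, eq_comm,
        Finset.sum_eq_zero_iff_of_nonneg fun i _ => sq_nonneg _] at hw
      exact hc0 (funext fun i => by simpa using hw i (Finset.mem_univ i))
    exact norm_pos_iff.mpr h1
  have hlow : (M.singularValues k * ‖g c‖) ^ 2 ≤ ‖M (g c)‖ ^ 2 := by
    rw [mul_pow, M.sq_singularValues_of_lt hn.symm hk, hw, hMw, Finset.mul_sum]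
    refine Finset.sum_le_sum fun i _ => ?_
    gcongr
    exact hev (Fin.le_def.mpr (Nat.lt_succ_iff.mp i.2))
  have hup : ‖M (g c)‖ ≤ r * ‖g c‖ := by
    refine (hM _).trans ((htail _ hXw).trans ?_)
    gcongr
    simpa using X.le_of_opNorm_le hX (g c)
  exact le_of_mul_le_mul_right ((le_of_sq_le_sq hlow (norm_nonneg _)).trans hup) hpos

/-- Determinants of compressions `Y T X` by contractions are bounded by the product of the leading
singular numbers of `T`. -/
theorem norm_det_comp_le_prod {E : Type*} [NormedAddCommGroup E] [InnerProductSpace ℂ E]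
    [FiniteDimensional ℂ E] (T : H →L[ℂ] H) {s : ℕ → ℝ} (hs0 : ∀ n, 0 ≤ s n) {v : ℕ → H}
    (htail : ∀ m x, (∀ j < m, inner ℂ (v j) x = 0) → ‖T x‖ ≤ s m * ‖x‖)
    (X : E →L[ℂ] H) (hX : ‖X‖ ≤ 1) (Y : H →L[ℂ] E) (hY : ‖Y‖ ≤ 1) :
    ‖LinearMap.det (Y ∘L T ∘L X).toLinearMap‖ ≤ ∏ i ∈ Finset.range (Module.finrank ℂ E), s i := by
  rw [← LinearMap.normDet_eq_norm_det, LinearMap.normDet_eq_prod_singularValues]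
  refine Finset.prod_le_prod (fun i _ => LinearMap.singularValues_nonneg _ _) fun i hi => ?_
  refine singularValues_le_of_tail _ T X hX (fun w => ?_) (Finset.mem_range.mp hi) (hs0 i) (htail i)
  simpa using Y.le_of_opNorm_le hY (T (X w))

theorem norm_det_comp_le_pow {E : Type*} [NormedAddCommGroup E] [InnerProductSpace ℂ E]
    [FiniteDimensional ℂ E] (T : H →L[ℂ] H)
    (X : E →L[ℂ] H) (hX : ‖X‖ ≤ 1) (Y : H →L[ℂ] E) (hY : ‖Y‖ ≤ 1) :
    ‖LinearMap.det (Y ∘L T ∘L X).toLinearMap‖ ≤ ‖T‖ ^ Module.finrank ℂ E := by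
  simpa using norm_det_comp_le_prod T (s := fun _ => ‖T‖) (fun _ => norm_nonneg T) (v := 0)
    (fun _ x _ => T.le_opNorm x) X hX Y hY

theorem differentiable_det_comp {E : Type*} [NormedAddCommGroup E] [InnerProductSpace ℂ E]
    [FiniteDimensional ℂ E] (X : E →L[ℂ] H) (Y : H →L[ℂ] E) :
    Differentiable ℂ fun T : H →L[ℂ] H => LinearMap.det (Y ∘L T ∘L X).toLinearMap := by
  let b := stdOrthonormalBasis ℂ E
  have h : ∀ T : H →L[ℂ] H, LinearMap.det (Y ∘L T ∘L X).toLinearMap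
      = Matrix.det (Matrix.of fun i j => inner ℂ (b i) (Y (T (X (b j))))) := by
    intro T
    rw [← LinearMap.det_toMatrix b.toBasis]
    congr 1
    ext i j
    simp [LinearMap.toMatrix_apply, b.repr_apply_apply]
  simp only [h, Matrix.det_apply, Matrix.of_apply]
  have hij : ∀ i j, Differentiable ℂ fun T : H →L[ℂ] H => inner ℂ (b i) (Y (T (X (b j)))) := by
    intro i j
    exact (innerSL ℂ (b i) ∘L Y ∘L ContinuousLinearMap.apply ℂ H (X (b j))).differentiable
  fun_prop

/-- The bound of `norm_det_comp_le_prod` is attained: compress to the first `n` singular vectors. -/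
theorem exists_norm_det_eq_prod [CompleteSpace H] {B : H →L[ℂ] H} {t : ℕ → ℝ}
    (ht0 : ∀ n, 0 ≤ t n) {u v : ℕ → H} (hu : Orthonormal ℂ u) (hv : Orthonormal ℂ v)
    (hB : ∀ j, B (v j) = (t j : ℂ) • u j) (n : ℕ) :
    ∃ (X : EuclideanSpace ℂ (Fin n) →L[ℂ] H) (Y : H →L[ℂ] EuclideanSpace ℂ (Fin n)),
      ‖X‖ ≤ 1 ∧ ‖Y‖ ≤ 1 ∧
      ‖LinearMap.det (Y ∘L B ∘L X).toLinearMap‖ = ∏ j ∈ Finset.range n, t j := by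
  have key : ∀ w : ℕ → H, Orthonormal ℂ w → ∃ W : EuclideanSpace ℂ (Fin n) →L[ℂ] H,
      ‖W‖ ≤ 1 ∧ (∀ i, W (EuclideanSpace.single i 1) = w i) := by
    intro w hw
    let g : EuclideanSpace ℂ (Fin n) →ₗ[ℂ] H :=
      (EuclideanSpace.basisFun (Fin n) ℂ).toBasis.constr ℂ fun i => w i
    have hg : ∀ x, g x = ∑ i, x i • w i := by
      intro x
      simp [g, Module.Basis.constr_apply_fintype]
    refine ⟨g.mkContinuous 1 fun x => ?_, LinearMap.mkContinuous_norm_le _ zero_le_one _, ?_⟩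
    · rw [one_mul, hg]
      refine le_of_sq_le_sq ?_ (norm_nonneg _)
      have h1 := (hw.comp _ Fin.val_injective).norm_sq_sum_smul Finset.univ fun i : Fin n => x i
      simp only [Function.comp_apply] at h1
      rw [h1, EuclideanSpace.norm_sq_eq]
    · intro i
      simp [hg]
  obtain ⟨X, hX, hXv⟩ := key v hv
  obtain ⟨Z, hZ, hZu⟩ := key u hu
  refine ⟨X, ContinuousLinearMap.adjoint Z, hX, by rwa [LinearIsometryEquiv.norm_map], ?_⟩
  have h : LinearMap.toMatrix (EuclideanSpace.basisFun (Fin n) ℂ).toBasis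
      (EuclideanSpace.basisFun (Fin n) ℂ).toBasis
      (ContinuousLinearMap.adjoint Z ∘L B ∘L X).toLinearMap
      = Matrix.diagonal fun i : Fin n => (t i : ℂ) := by
    ext i j
    rw [LinearMap.toMatrix_apply, OrthonormalBasis.coe_toBasis_repr_apply,
      OrthonormalBasis.repr_apply_apply]
    simp only [OrthonormalBasis.coe_toBasis, EuclideanSpace.basisFun_apply]
    change inner ℂ _ (ContinuousLinearMap.adjoint Z (B (X _))) = _
    rw [ContinuousLinearMap.adjoint_inner_right, hXv, hZu, hB, inner_smul_right,
      orthonormal_iff_ite.mp hu]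
    by_cases hij : i = j
    · subst hij; simp
    · simp [hij, Fin.val_inj]
  rw [← LinearMap.det_toMatrix (EuclideanSpace.basisFun (Fin n) ℂ).toBasis, h, Matrix.det_diagonal,
    norm_prod, ← Fin.prod_univ_eq_prod_range]
  refine Finset.prod_congr rfl fun i _ => ?_
  rw [Complex.norm_real, Real.norm_of_nonneg (ht0 i)]

/-! ### Finite sections of the conjugated operator -/

/-- The diagonal operator with entries `c k` for `k < N` and `0` for `k ≥ N` in the basis `e`. -/
noncomputable def diagTrunc (e : HilbertBasis ℕ ℂ H) (N : ℕ) (c : ℕ → ℂ) : H →L[ℂ] H :=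
  sumRankOne e e (Finset.range N) c

/-- The `N × N` section of `D⁻¹ A D`, regarded as an operator on the whole space. -/
noncomputable def conjTrunc (e : HilbertBasis ℕ ℂ H) (d : ℕ → ℝ) (N : ℕ) (A : H →L[ℂ] H) :
    H →L[ℂ] H :=
  diagTrunc e N (fun k => (d k : ℂ)⁻¹) ∘L A ∘L diagTrunc e N (fun k => (d k : ℂ))

theorem repr_diagTrunc (e : HilbertBasis ℕ ℂ H) (N : ℕ) (c : ℕ → ℂ) (x : H) (i : ℕ) :
    e.repr (diagTrunc e N c x) i = if i < N then c i * e.repr x i else 0 := by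
  rw [HilbertBasis.repr_apply_apply, HilbertBasis.repr_apply_apply, diagTrunc, sumRankOne_apply]
  split_ifs with h
  · rw [e.orthonormal.inner_right_sum _ (Finset.mem_range.mpr h)]
  · rw [inner_sum]
    refine Finset.sum_eq_zero fun k hk => ?_
    have : i ≠ k := fun hik => h (hik ▸ Finset.mem_range.mp hk)
    rw [inner_smul_right, e.orthonormal.2 this, mul_zero]

theorem HilbertBasis.ext_repr (e : HilbertBasis ℕ ℂ H) {x y : H}
    (h : ∀ i, e.repr x i = e.repr y i) : x = y :=
  e.repr.injective (lp.ext (funext h))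

theorem diagTrunc_comp (e : HilbertBasis ℕ ℂ H) (N M : ℕ) (c c' : ℕ → ℂ) :
    diagTrunc e N c ∘L diagTrunc e M c' = diagTrunc e (min N M) (c * c') := by
  ext x
  refine e.ext_repr fun i => ?_
  simp only [ContinuousLinearMap.comp_apply, repr_diagTrunc, lt_min_iff, Pi.mul_apply]
  split_ifs <;> simp_all [mul_assoc]

theorem norm_diagTrunc_le (e : HilbertBasis ℕ ℂ H) (N : ℕ) {c : ℕ → ℂ} (hc : ∀ k, ‖c k‖ ≤ 1) :
    ‖diagTrunc e N c‖ ≤ 1 :=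
  norm_sumRankOne_le e.orthonormal e.orthonormal _ _ zero_le_one fun k _ => hc k

theorem diagTrunc_comp_comp_diagTrunc (e : HilbertBasis ℕ ℂ H) (N : ℕ) (c c' : ℕ → ℂ)
    (A : H →L[ℂ] H) : diagTrunc e N c ∘L A ∘L diagTrunc e N c' =
      ∑ k ∈ Finset.range N, ∑ l ∈ Finset.range N,
        (c k * c' l * inner ℂ (e k) (A (e l))) • InnerProductSpace.rankOne ℂ (e k) (e l) := by
  ext x
  simp only [ContinuousLinearMap.comp_apply, diagTrunc, sumRankOne_apply, map_sum, map_smul,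
    Finset.smul_sum, sum_apply, smul_apply, InnerProductSpace.rankOne_apply, smul_smul]
  rw [Finset.sum_comm]
  refine Finset.sum_congr rfl fun k _ => Finset.sum_congr rfl fun l _ => ?_
  congr 1
  ring

/-! ### Complex interpolation on the right half-plane -/

/-- For lower-triangular `A` the entries `exp (-z (a k - a l)) ⟨e k, A e l⟩` of the conjugated section
vanish unless `l ≤ k`, so they are bounded on the right half-plane. The bound may depend on `N`. -/
theorem norm_conj_exp_le (e : HilbertBasis ℕ ℂ H) {A : H →L[ℂ] H}
    (hA : ∀ i j : ℕ, i < j → inner ℂ (e i) (A (e j)) = 0) {a : ℕ → ℝ} (ha : Monotone a) (N : ℕ)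
    {z : ℂ} (hz : 0 ≤ z.re) :
    ‖diagTrunc e N (fun k => Complex.exp (-z * a k)) ∘L A ∘L
        diagTrunc e N (fun k => Complex.exp (z * a k))‖
      ≤ ∑ k ∈ Finset.range N, ∑ l ∈ Finset.range N, ‖(inner ℂ (e k) (A (e l)) : ℂ)‖ := by
  rw [diagTrunc_comp_comp_diagTrunc]
  refine norm_sum_le_of_le _ fun k _ => norm_sum_le_of_le _ fun l _ => ?_
  rw [norm_smul, InnerProductSpace.norm_rankOne, e.orthonormal.1, e.orthonormal.1, mul_one, mul_one]
  rcases lt_or_ge k l with hkl | hkl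
  · simp [hA k l hkl]
  · rw [norm_mul, ← Complex.exp_add, Complex.norm_exp]
    refine mul_le_of_le_one_left (norm_nonneg _) (Real.exp_le_one_iff.mpr ?_)
    have h1 : (-z * (a k : ℂ) + z * (a l : ℂ)).re = -(z.re * (a k - a l)) := by
      simp
      ring
    rw [h1, neg_nonpos]
    exact mul_nonneg hz (sub_nonneg.mpr (ha hkl))

/-- Phragmén–Lindelöf bound: `z ↦ D⁻ᶻ A Dᶻ` (cut off at `N`) joins `conjTrunc e d N A` at `z = 1` to
operators `C A C'` with contractions `C`, `C'` on the imaginary axis. Hence a bound on the latter for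
a differentiable function `G` of polynomial growth also holds at `conjTrunc e d N A`. -/
theorem norm_comp_conjTrunc_le (e : HilbertBasis ℕ ℂ H) {A : H →L[ℂ] H}
    (hA : ∀ i j : ℕ, i < j → inner ℂ (e i) (A (e j)) = 0) {d : ℕ → ℝ} (hd : Monotone d)
    (hd0 : ∀ j, 0 < d j) {V : Type*} [NormedAddCommGroup V] [NormedSpace ℂ V]
    {G : (H →L[ℂ] H) → V} (hG : Differentiable ℂ G) {p : ℕ} (hGp : ∀ T, ‖G T‖ ≤ ‖T‖ ^ p) {K : ℝ}
    (hK : ∀ C C' : H →L[ℂ] H, ‖C‖ ≤ 1 → ‖C'‖ ≤ 1 → ‖G (C ∘L A ∘L C')‖ ≤ K) (N : ℕ) :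
    ‖G (conjTrunc e d N A)‖ ≤ K := by
  set a : ℕ → ℝ := fun k => Real.log (d k) with ha
  have ham : Monotone a := fun i j hij => Real.log_le_log (hd0 i) (hd hij)
  set F : ℂ → (H →L[ℂ] H) := fun z => diagTrunc e N (fun k => Complex.exp (-z * a k)) ∘L A ∘L
    diagTrunc e N (fun k => Complex.exp (z * a k)) with hF
  set C : ℝ := ∑ k ∈ Finset.range N, ∑ l ∈ Finset.range N, ‖(inner ℂ (e k) (A (e l)) : ℂ)‖ with hC
  have hexp : ∀ k, Complex.exp (a k) = d k := fun k => by
    rw [ha, ← Complex.ofReal_exp, Real.exp_log (hd0 k)]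
  have h1 : F 1 = conjTrunc e d N A := by
    simp only [hF, conjTrunc, one_mul, neg_mul, Complex.exp_neg, hexp]
  have hFC : ∀ z : ℂ, 0 ≤ z.re → ‖G (F z)‖ ≤ C ^ p := fun z hz =>
    (hGp _).trans (pow_le_pow_left₀ (norm_nonneg _) (norm_conj_exp_le e hA ham N hz) p)
  have hFd : Differentiable ℂ F := by
    simp only [hF, diagTrunc_comp_comp_diagTrunc]
    fun_prop
  rw [← h1]
  refine PhragmenLindelof.right_half_plane_of_bounded_on_real (f := G ∘ F)
    (hG.comp hFd).diffContOnCl ⟨0, by norm_num, 0, ?_⟩ ?_ (fun x => ?_) (by simp)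
  · refine Asymptotics.IsBigO.of_bound (C ^ p) (mem_inf_of_right fun z hz => ?_)
    simpa using hFC z (le_of_lt hz)
  · refine ⟨C ^ p, eventually_map.mpr ?_⟩
    filter_upwards [eventually_ge_atTop 0] with x hx
    exact hFC x (by simpa using hx)
  · refine hK _ _ (norm_diagTrunc_le e N fun k => ?_) (norm_diagTrunc_le e N fun k => ?_) <;>
    · rw [Complex.norm_exp]
      simp

theorem norm_conjTrunc_le (e : HilbertBasis ℕ ℂ H) {A : H →L[ℂ] H}
    (hA : ∀ i j : ℕ, i < j → inner ℂ (e i) (A (e j)) = 0) {d : ℕ → ℝ} (hd : Monotone d)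
    (hd0 : ∀ j, 0 < d j) (N : ℕ) : ‖conjTrunc e d N A‖ ≤ ‖A‖ := by
  refine norm_comp_conjTrunc_le e hA hd hd0 (G := id) differentiable_id (p := 1) (by simp)
    (fun C C' hC hC' => ?_) N
  calc ‖C ∘L A ∘L C'‖ ≤ ‖C‖ * (‖A‖ * ‖C'‖) :=
        (ContinuousLinearMap.opNorm_comp_le _ _).trans
          (by gcongr; exact ContinuousLinearMap.opNorm_comp_le _ _)
    _ ≤ 1 * (‖A‖ * 1) := by gcongr
    _ = ‖A‖ := by ring

/-! ### The norm limit of the finite sections -/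

/-- The `N × N` section of `A` in the basis `e`, regarded as an operator on the whole space. -/
noncomputable def trunc (e : HilbertBasis ℕ ℂ H) (N : ℕ) (A : H →L[ℂ] H) : H →L[ℂ] H :=
  diagTrunc e N 1 ∘L A ∘L diagTrunc e N 1

theorem conjTrunc_trunc (e : HilbertBasis ℕ ℂ H) (d : ℕ → ℝ) {N K : ℕ} (hNK : N ≤ K)
    (A : H →L[ℂ] H) : conjTrunc e d K (trunc e N A) = conjTrunc e d N A := by
  have h1 : ∀ c, diagTrunc e K c ∘L diagTrunc e N 1 = diagTrunc e N c := fun c => by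
    rw [diagTrunc_comp, min_eq_right hNK, mul_one]
  have h2 : ∀ c, diagTrunc e N 1 ∘L diagTrunc e K c = diagTrunc e N c := fun c => by
    rw [diagTrunc_comp, min_eq_left hNK, one_mul]
  rw [conjTrunc, conjTrunc, trunc, ← h1 fun k => (d k : ℂ)⁻¹, ← h2 fun k => (d k : ℂ)]
  simp only [ContinuousLinearMap.comp_assoc]

theorem conjTrunc_sub (e : HilbertBasis ℕ ℂ H) (d : ℕ → ℝ) (N : ℕ) (A A' : H →L[ℂ] H) :
    conjTrunc e d N (A - A') = conjTrunc e d N A - conjTrunc e d N A' := by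
  simp only [conjTrunc, ContinuousLinearMap.sub_comp, ContinuousLinearMap.comp_sub]

theorem inner_trunc (e : HilbertBasis ℕ ℂ H) (N : ℕ) {A : H →L[ℂ] H}
    (hA : ∀ i j : ℕ, i < j → inner ℂ (e i) (A (e j)) = 0) (i j : ℕ) (hij : i < j) :
    inner ℂ (e i) (trunc e N A (e j)) = 0 := by
  have h1 : diagTrunc e N 1 (e j) = if j < N then e j else 0 := by
    refine e.ext_repr fun k => ?_
    rw [repr_diagTrunc]
    by_cases hk : k = j
    · subst hk; split_ifs <;> simp
    · split_ifs <;> simp [e.repr_apply_apply, e.orthonormal.2 hk]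
  rw [← e.repr_apply_apply, trunc, ContinuousLinearMap.comp_apply, repr_diagTrunc,
    ContinuousLinearMap.comp_apply, h1]
  split_ifs
  · rw [e.repr_apply_apply, hA i j hij, mul_zero]
  · simp
  · rfl

theorem tendsto_diagTrunc_one (e : HilbertBasis ℕ ℂ H) (x : H) :
    Tendsto (fun N => diagTrunc e N 1 x) atTop (𝓝 x) := by
  have := (e.hasSum_repr x).tendsto_sum_nat
  simpa [diagTrunc, sumRankOne_apply, e.repr_apply_apply] using this

theorem continuous_rankOne :
    Continuous fun q : H × H => (InnerProductSpace.rankOne ℂ q.1 q.2 : H →L[ℂ] H) := by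
  have h : ∀ q : H × H, (InnerProductSpace.rankOne ℂ q.1 q.2 : H →L[ℂ] H)
      = ContinuousLinearMap.smulRightL ℂ H H (innerSL ℂ q.2) q.1 := fun q => by
    ext x
    simp
  simp only [h]
  fun_prop

theorem inner_diagTrunc_one (e : HilbertBasis ℕ ℂ H) (N : ℕ) (v x : H) :
    inner ℂ v (diagTrunc e N 1 x) = inner ℂ (diagTrunc e N 1 v) x := by
  simp only [diagTrunc, sumRankOne_apply, inner_sum, sum_inner, inner_smul_left,
    inner_smul_right, Pi.one_apply, one_mul, inner_conj_symm]
  exact Finset.sum_congr rfl fun k _ => mul_comm _ _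

theorem trunc_rankOne (e : HilbertBasis ℕ ℂ H) (u v : H) (N : ℕ) :
    trunc e N (InnerProductSpace.rankOne ℂ u v)
      = InnerProductSpace.rankOne ℂ (diagTrunc e N 1 u) (diagTrunc e N 1 v) := by
  ext x
  simp [trunc, inner_diagTrunc_one]

theorem tendsto_trunc_rankOne (e : HilbertBasis ℕ ℂ H) (u v : H) :
    Tendsto (fun N => trunc e N (InnerProductSpace.rankOne ℂ u v)) atTop
      (𝓝 (InnerProductSpace.rankOne ℂ u v)) := by
  have h : Tendsto (fun N => (diagTrunc e N 1 u, diagTrunc e N 1 v)) atTop (𝓝 (u, v)) :=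
    (tendsto_diagTrunc_one e u).prodMk_nhds (tendsto_diagTrunc_one e v)
  have h2 := (continuous_rankOne.tendsto (u, v)).comp h
  exact h2.congr fun N => (trunc_rankOne e u v N).symm

theorem norm_trunc_le (e : HilbertBasis ℕ ℂ H) (N : ℕ) (A : H →L[ℂ] H) :
    ‖trunc e N A‖ ≤ ‖A‖ := by
  have h1 : ‖diagTrunc e N 1‖ ≤ 1 := norm_diagTrunc_le e N (by simp)
  calc ‖trunc e N A‖ ≤ ‖diagTrunc e N 1‖ * (‖A‖ * ‖diagTrunc e N 1‖) :=
        (ContinuousLinearMap.opNorm_comp_le _ _).trans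
          (by gcongr; exact ContinuousLinearMap.opNorm_comp_le _ _)
    _ ≤ 1 * (‖A‖ * 1) := by gcongr
    _ = ‖A‖ := by ring

theorem trunc_sub (e : HilbertBasis ℕ ℂ H) (N : ℕ) (A A' : H →L[ℂ] H) :
    trunc e N (A - A') = trunc e N A - trunc e N A' := by
  simp only [trunc, ContinuousLinearMap.sub_comp, ContinuousLinearMap.comp_sub]

theorem tendsto_trunc_sumRankOne (e : HilbertBasis ℕ ℂ H) (u v : ℕ → H) (F : Finset ℕ)
    (c : ℕ → ℂ) : Tendsto (fun N => trunc e N (sumRankOne u v F c)) atTop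
      (𝓝 (sumRankOne u v F c)) := by
  have h1 : ∀ N, trunc e N (sumRankOne u v F c)
      = ∑ k ∈ F, c k • trunc e N (InnerProductSpace.rankOne ℂ (u k) (v k)) := by
    intro N
    ext x
    simp [trunc, sumRankOne, map_sum]
  simp only [h1]
  exact tendsto_finsetSum _ fun k _ => (tendsto_trunc_rankOne e (u k) (v k)).const_smul (c k)

theorem tendsto_trunc (e : HilbertBasis ℕ ℂ H) {A : H →L[ℂ] H} {s : ℕ → ℝ}
    (hA : IsSingularNumbers A s) : Tendsto (fun N => trunc e N A) atTop (𝓝 A) := by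
  obtain ⟨hs, hs0, hlim, u, v, hu, hv, hsum⟩ := hA
  rw [Metric.tendsto_atTop]
  intro ε hε
  obtain ⟨m, hm⟩ := (hlim.eventually (gt_mem_nhds (show (0 : ℝ) < ε / 3 by positivity))).exists
  set S := sumRankOne u v (Finset.range m) (fun k => (s k : ℂ))
  have hAS : ‖A - S‖ < ε / 3 := (norm_sub_sumRankOne_le hs0 hv (apply_eq_of_hasSum hv hsum)
    (norm_apply_le_of_hasSum hs hs0 hu hv hsum) m).trans_lt hm
  obtain ⟨N₀, hN₀⟩ := Metric.tendsto_atTop.mp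
    (tendsto_trunc_sumRankOne e u v (Finset.range m) fun k => (s k : ℂ)) (ε / 3) (by positivity)
  refine ⟨N₀, fun N hN => ?_⟩
  have h1 := hN₀ N hN
  rw [dist_eq_norm] at h1 ⊢
  have h2 : trunc e N A - A = trunc e N (A - S) + (trunc e N S - S) - (A - S) := by
    rw [trunc_sub]; abel
  calc ‖trunc e N A - A‖ ≤ ‖trunc e N (A - S)‖ + ‖trunc e N S - S‖ + ‖A - S‖ := by
        rw [h2]
        exact (norm_sub_le _ _).trans (by gcongr; exact norm_add_le _ _)
    _ < ε / 3 + ε / 3 + ε / 3 := by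
        gcongr
        exact (norm_trunc_le e N _).trans_lt hAS
    _ = ε := by ring

/-- `conjTrunc e d N A` and `conjTrunc e d M A` are conjugates by one section of `D` of the
lower-triangular operators `trunc e N A` and `trunc e M A`, so `norm_conjTrunc_le` applies to the
difference of these two. -/
theorem cauchySeq_conjTrunc (e : HilbertBasis ℕ ℂ H) {A : H →L[ℂ] H}
    (hA : ∀ i j : ℕ, i < j → inner ℂ (e i) (A (e j)) = 0) {d : ℕ → ℝ} (hd : Monotone d)
    (hd0 : ∀ j, 0 < d j) (hlim : Tendsto (fun N => trunc e N A) atTop (𝓝 A)) :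
    CauchySeq fun N => conjTrunc e d N A := by
  have hc := hlim.cauchySeq
  rw [Metric.cauchySeq_iff] at hc ⊢
  intro ε hε
  obtain ⟨N₀, hN₀⟩ := hc ε hε
  refine ⟨N₀, fun m hm n hn => lt_of_le_of_lt ?_ (hN₀ m hm n hn)⟩
  rw [dist_eq_norm, dist_eq_norm, ← conjTrunc_trunc e d (le_max_left m n) A,
    ← conjTrunc_trunc e d (le_max_right m n) A, ← conjTrunc_sub]
  refine norm_conjTrunc_le e (fun i j hij => ?_) hd hd0 _
  rw [sub_apply, inner_sub_right, inner_trunc e m hA i j hij, inner_trunc e n hA i j hij,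
    sub_self]

theorem isCompactOperator_sumRankOne (u v : ℕ → H) (F : Finset ℕ) (c : ℕ → ℂ) :
    IsCompactOperator (sumRankOne u v F c) := by
  have h1 : sumRankOne u v F c ∈ compactOperator (RingHom.id ℂ) H H := by
    refine Submodule.sum_mem _ fun k _ => Submodule.smul_mem _ _ ?_
    exact (isCompactOperator_of_locallyCompactSpace_rng
      (ContinuousLinearMap.toSpanSingleton ℂ (u k))).comp_clm (innerSL ℂ (v k))
  exact h1

theorem extendsConj_of_tendsto (e : HilbertBasis ℕ ℂ H) {A B : H →L[ℂ] H} {d : ℕ → ℝ}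
    (hd0 : ∀ j, 0 < d j)
    (hB : Tendsto (fun N => conjTrunc e d N A) atTop (𝓝 B)) :
    ExtendsConj (diagonalOp e d) A B := by
  intro x
  have hD : ∀ (y : (diagonalOp e d).domain) i,
      e.repr (diagonalOp e d y) i = d i * e.repr (y : H) i := by
    intro y i
    change e.repr (e.repr.symm (diagonalCoord e d y)) i = _
    rw [LinearIsometryEquiv.apply_symm_apply]
    rfl
  have hBx : ∀ i, e.repr (B x) i = (d i : ℂ)⁻¹ * e.repr (A (diagonalOp e d x)) i := by
    intro i
    have h1 : Tendsto (fun N => e.repr (conjTrunc e d N A x) i) atTop (𝓝 (e.repr (B x) i)) := by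
      simp only [e.repr_apply_apply]
      exact ((innerSL ℂ (e i)) ∘L (ContinuousLinearMap.apply ℂ H (x : H))).continuous.tendsto B
        |>.comp hB
    refine tendsto_nhds_unique h1 ?_
    have h2 : ∀ N, diagTrunc e N (fun k => (d k : ℂ)) x = diagTrunc e N 1 (diagonalOp e d x) := by
      intro N
      refine e.ext_repr fun k => ?_
      rw [repr_diagTrunc, repr_diagTrunc, hD, Pi.one_apply, one_mul]
    have h3 : Tendsto (fun N => (d i : ℂ)⁻¹ * e.repr (A (diagTrunc e N 1 (diagonalOp e d x))) i)
        atTop (𝓝 ((d i : ℂ)⁻¹ * e.repr (A (diagonalOp e d x)) i)) := by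
      simp only [e.repr_apply_apply]
      exact ((((innerSL ℂ (e i)) ∘L A).continuous.tendsto _).comp
        (tendsto_diagTrunc_one e (diagonalOp e d x))).const_mul _
    refine h3.congr' ?_
    filter_upwards [eventually_gt_atTop i] with N hN
    rw [conjTrunc, ContinuousLinearMap.comp_apply, ContinuousLinearMap.comp_apply, repr_diagTrunc,
      if_pos hN, h2]
  have hmul : ∀ i, (d i : ℂ) * e.repr (B x) i = e.repr (A (diagonalOp e d x)) i := by
    intro i
    rw [hBx, ← mul_assoc, mul_inv_cancel₀, one_mul]
    exact_mod_cast (hd0 i).ne'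
  have hmem : B x ∈ (diagonalOp e d).domain := by
    change Memℓp (fun j : ℕ => (d j : ℂ) * e.repr (B x) j) 2
    simp only [hmul]
    exact lp.memℓp _
  refine ⟨⟨B x, hmem⟩, e.ext_repr fun i => ?_, rfl⟩
  rw [hD]
  exact hmul i

end

theorem theorem3p8 {H : Type*} [NormedAddCommGroup H] [InnerProductSpace ℂ H] [CompleteSpace H]
    (e : HilbertBasis ℕ ℂ H) (A : H →L[ℂ] H)
    (hA : ∀ i j : ℕ, i < j → inner ℂ (e i) (A (e j)) = 0)
    (hAc : IsCompactOperator A)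
    (d : ℕ → ℝ) (hd : Monotone d) (hd0 : ∀ j, 0 < d j) :
    ∃ B : H →L[ℂ] H, ExtendsConj (diagonalOp e d) A B ∧ IsCompactOperator B ∧
      (∃ s, IsSingularNumbers A s) ∧ (∃ t, IsSingularNumbers B t) ∧
      ∀ s t : ℕ → ℝ, IsSingularNumbers A s → IsSingularNumbers B t →
        ∀ n : ℕ, 1 ≤ n → ∏ j ∈ Finset.range n, t j ≤ ∏ j ∈ Finset.range n, s j := by
  obtain ⟨s₀, hs₀⟩ := exists_isSingularNumbers e.orthonormal A hAc
  obtain ⟨B, hB⟩ := cauchySeq_tendsto_of_complete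
    (cauchySeq_conjTrunc e hA hd hd0 (tendsto_trunc e hs₀))
  have hBc : IsCompactOperator B := by
    refine isCompactOperator_of_tendsto hB (Eventually.of_forall fun N => ?_)
    exact (isCompactOperator_sumRankOne _ _ _ _).comp_clm _
  refine ⟨B, extendsConj_of_tendsto e hd0 hB, hBc, ⟨s₀, hs₀⟩,
    exists_isSingularNumbers e.orthonormal B hBc, ?_⟩
  rintro s t ⟨hs, hs0, -, u, v, hu, hv, hsum⟩ ⟨-, ht0, -, u', v', hu', hv', hsum'⟩ n -
  obtain ⟨X, Y, hX, hY, hXY⟩ := exists_norm_det_eq_prod ht0 hu' hv' (apply_eq_of_hasSum hv' hsum') n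
  have hdiff := differentiable_det_comp X Y
  rw [← hXY]
  refine le_of_tendsto ((hdiff.continuous.tendsto B).comp hB).norm (Eventually.of_forall fun N => ?_)
  -- on the imaginary axis, the contractions `C` and `C'` are absorbed into `Y` and `X`
  refine norm_comp_conjTrunc_le e hA hd hd0 hdiff (fun T => norm_det_comp_le_pow T X hX Y hY)
    (fun C C' hC hC' => ?_) N
  have h1 := norm_det_comp_le_prod A hs0 (norm_apply_le_of_hasSum hs hs0 hu hv hsum) (C' ∘L X)
    ((ContinuousLinearMap.opNorm_comp_le _ _).trans (mul_le_one₀ hC' (norm_nonneg _) hX)) (Y ∘L C)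
    ((ContinuousLinearMap.opNorm_comp_le _ _).trans (mul_le_one₀ hY (norm_nonneg _) hC))
  simpa [ContinuousLinearMap.comp_assoc] using h1
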